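/- Let $n\ge 1$, $K\ge 1$, $\mu>0$, and let $\mathcal C$ be a nonempty class of $N$ subsets of $\{1,\dots,n\}$, all of cardinality $K$. Let $\mathbb P_0$ be the law on $\mathbb R^n$ of a vector with independent $\mathcal N(0,1)$ components, and for $S\in\mathcal C$ let $\mathbb P_S$ be the law of a vector with independent components that are $\mathcal N(\mu,1)$ for $i\in S$ and $\mathcal N(0,1)$ for $i\notin S$. The risk of a test $f:\mathbb R^n\to\{0,1\}$ is $$R(f)=\mathbb P_0\{f=1\}+\frac1N\sum_{S\in\mathcal C}\mathbb P_S\{f=0\}.$$ Let $f^*_{\mathcal C}(x)=1$ if $\frac1N\sum_{S\in\mathcal C}\exp\bigl(\mu\sum_{i\in S}x_i-K\mu^2/2\bigr)>1$ and $f^*_{\mathcal C}(x)=0$ otherwise (the optimal test), and let $R^*_{\mathcal C}=R(f^*_{\mathcal C})$. Assume that $\mathcal C$ is symmetric, i.e. that $\mathbb P_T\{f^*_{\mathcal C}=0\}$ takes the same value for all $T\in\mathcal C$ (for the given $\mu$). For $t\ge 0$ let $M(t)$ be the packing number of $\mathcal C$, that is, the largest cardinality of a subclass $\mathcal A\subset\mathcal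 C$ such that $d(S,T)\ge t$ for all distinct $S,T\in\mathcal A$, where $d(S,T)=\sqrt{|S\,\triangle\, T|}$ is the canonical distance (the square root of the Hamming distance). **Theorem.** If $0\le t\le\sqrt{2K}$, then $R^*_{\mathcal C}\ge \tfrac12$ whenever $M(t)\ge 16$ and $$\mu\le\min\left(\sqrt{\frac{\log(M(t)/16)}{K}},\ \frac{8\log(2/\sqrt3)}{\sqrt{K-t^2/2}}\right),$$ where the second term in the minimum is read as $+\infty$ if $t=\sqrt{2K}$. -/

import Mathlib

namespace CombTest

open MeasureTheory ProbabilityTheory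

noncomputable section

/-- The law of `X` when the coordinates are independent, with `X i ~ N(μ, 1)` for `i ∈ S`
and `X i ~ N(0, 1)` for `i ∉ S`. -/
def law {n : ℕ} (μ : ℝ) (S : Finset (Fin n)) : Measure (Fin n → ℝ) :=
  Measure.pi fun i => gaussianReal (if i ∈ S then μ else 0) 1

/-- The law of `X` under the null hypothesis: independent standard normal coordinates. -/
def nullLaw (n : ℕ) : Measure (Fin n → ℝ) :=
  Measure.pi fun _ => gaussianReal 0 1

/-- The risk of a test `f` for the class `C`: the probability of a type I error plus the average
over `S ∈ C` of the probability of a type II error. -/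
def risk {n : ℕ} (C : Finset (Finset (Fin n))) (μ : ℝ) (f : (Fin n → ℝ) → Fin 2) : ℝ :=
  (nullLaw n).real {x | f x = 1} + (1 / (C.card : ℝ)) * ∑ S ∈ C, (law μ S).real {x | f x = 0}

/-- The likelihood ratio of the uniform mixture over `C` against the null law. -/
def likelihoodRatio {n : ℕ} (C : Finset (Finset (Fin n))) (μ : ℝ) (x : Fin n → ℝ) : ℝ :=
  (1 / (C.card : ℝ)) * ∑ S ∈ C, Real.exp (μ * ∑ i ∈ S, x i - (S.card : ℝ) * μ ^ 2 / 2)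

/-- The optimal test: reject when the likelihood ratio exceeds `1`. -/
def optimalTest {n : ℕ} (C : Finset (Finset (Fin n))) (μ : ℝ) (x : Fin n → ℝ) : Fin 2 :=
  if 1 < likelihoodRatio C μ x then 1 else 0

/-- The Bayes risk, i.e. the risk of the optimal test. -/
def optimalRisk {n : ℕ} (C : Finset (Finset (Fin n))) (μ : ℝ) : ℝ :=
  risk C μ (optimalTest C μ)

/-- `C` is symmetric (at the level `μ`): the type II error probability of the optimal test is
the same under all the alternatives `T ∈ C`. -/
def IsSymmetric {n : ℕ} (C : Finset (Finset (Fin n))) (μ : ℝ) : Prop :=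
  ∀ T ∈ C, ∀ T' ∈ C,
    (law μ T).real {x | optimalTest C μ x = 0} = (law μ T').real {x | optimalTest C μ x = 0}

/-- The canonical distance: the square root of the Hamming distance. -/
def canonicalDist {n : ℕ} (S T : Finset (Fin n)) : ℝ :=
  Real.sqrt ((symmDiff S T).card : ℝ)

/-- Distinct members of `A` are at canonical distance at least `t`. -/
def IsSeparated {n : ℕ} (t : ℝ) (A : Finset (Finset (Fin n))) : Prop :=
  ∀ S ∈ A, ∀ T ∈ A, S ≠ T → t ≤ canonicalDist S T

open Classical in
/-- The packing number `M(t)`: the largest cardinality of a `t`-separated subclass of `C`. -/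
def packingNumber {n : ℕ} (C : Finset (Finset (Fin n))) (t : ℝ) : ℕ :=
  (C.powerset.filter (fun A => IsSeparated t A)).sup Finset.card

end

end CombTest

/-! By symmetry the optimal test of `C` has the same type II error against every member of `C`, so
averaging over a subclass `A` leaves its risk unchanged (`optimalRisk_eq_risk`). Take for `A` a
`t`-separated subclass with M = M(t) members and let L be its likelihood ratio. Any test has risk
over `A` at least 1 - E|L - 1|/2 (`one_sub_le_risk`), so it suffices that E|L - 1| ≤ 1 under the
null law.

There L is an average of M normalized exponentials of a centred Gaussian vector with covariances
μ²|S ∩ T|. The variances are μ²K, and separation bounds the other entries by μ²(K - t²/2). Raising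
covariances at fixed variances raises the mean deviation, so these entries may all be replaced by a
common a². Then L = UV with U = exp(aX - a²/2) and V an independent average of M independent
log-normals, whence E|UV - 1| ≤ E|V - 1| + E|U - 1|. The first term is small because M ≥ 16
exp(μ²K); the second is 2P(|X| ≤ a/2).

The comparison (`integral_expSumDev_le_of_covariance_le`) is of Slepian type but needs no
differentiation. By convexity of |·|, giving two coordinates the same noise instead of independent
copies raises the mean deviation (`expSumDev_add_swap_le`). Small increases of covariance are made
of such mergers, fed by an independent noise of variance η on each coordinate. That noise is itself
added at the right cost by Jensen (`integral_expSumDev_le_add_noise`); η stays fixed at 0.01 and the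
numerical slack pays for it. -/

namespace CombTest

open MeasureTheory ProbabilityTheory Matrix WithLp

/-! ### Centred Gaussian vectors: linear images, sums and exponential moments. -/

section GaussianVectors

variable {ι κ : Type*} [Fintype ι] [DecidableEq ι] [Fintype κ]

/-- The sum of independent centred Gaussian vectors is Gaussian, with the sum of the covariances. -/
theorem map_add_multivariateGaussian {A B : Matrix ι ι ℝ} (hA : A.PosSemidef)
    (hB : B.PosSemidef) :
    ((multivariateGaussian 0 A).prod (multivariateGaussian 0 B)).map (fun z => z.1 + z.2) =
      multivariateGaussian 0 (A + B) := by
  change (multivariateGaussian 0 A) ∗ (multivariateGaussian 0 B) = _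
  apply Measure.ext_of_charFun
  ext t
  rw [charFun_conv, charFun_multivariateGaussian hA, charFun_multivariateGaussian hB,
    charFun_multivariateGaussian (hA.add hB), ← Complex.exp_add]
  congr 1
  simp [Matrix.add_mulVec, dotProduct_add]
  ring

/-- The linear image of a standard Gaussian vector under a matrix `V` has covariance `V Vᵀ`. -/
theorem map_mulVec_pi_gaussianReal (V : Matrix ι κ ℝ) :
    (Measure.pi fun _ : κ => gaussianReal 0 1).map (fun x => toLp 2 (V *ᵥ x)) =
      multivariateGaussian 0 (V * Vᵀ) := by
  have hV : (V * Vᵀ).PosSemidef := by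
    simpa using posSemidef_self_mul_conjTranspose V
  have hm : Measurable (fun x : κ → ℝ => toLp 2 (V *ᵥ x)) := by
    apply Continuous.measurable
    fun_prop
  have : IsProbabilityMeasure
      ((Measure.pi fun _ : κ => gaussianReal 0 1).map (fun x => toLp 2 (V *ᵥ x))) :=
    Measure.isProbabilityMeasure_map hm.aemeasurable
  apply Measure.ext_of_charFun
  ext t
  rw [charFun_multivariateGaussian hV, charFun_apply,
    integral_map hm.aemeasurable (by fun_prop)]
  have h1 : ∀ x : κ → ℝ, Complex.exp ((inner ℝ (toLp 2 (V *ᵥ x)) t : ℝ) * Complex.I) =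
      ∏ k, Complex.exp (((ofLp t ᵥ* V) k : ℝ) * (x k : ℝ) * Complex.I) := by
    intro x
    rw [← Complex.exp_sum, ← Finset.sum_mul, EuclideanSpace.inner_eq_star_dotProduct]
    simp only [star_trivial]
    rw [dotProduct_mulVec]
    simp only [dotProduct]
    push_cast
    rfl
  simp_rw [h1]
  rw [integral_fintype_prod_eq_prod
    (f := fun k (y : ℝ) => Complex.exp (((ofLp t ᵥ* V) k : ℝ) * (y : ℝ) * Complex.I))]
  simp_rw [← charFun_apply_real, charFun_gaussianReal]
  rw [← Complex.exp_sum]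
  congr 1
  have h2 : ofLp t ⬝ᵥ (V * Vᵀ) *ᵥ ofLp t = ∑ k, ((ofLp t ᵥ* V) k) ^ 2 := by
    rw [← mulVec_mulVec, dotProduct_mulVec, mulVec_transpose]
    simp [dotProduct, pow_two]
  rw [h2]
  simp [Finset.sum_div]

/-- Adding two independent rank one centred Gaussian vectors. -/
theorem map_add_smul_add_smul {B : Matrix ι ι ℝ} (hB : B.PosSemidef) (a b : ι → ℝ) :
    ((multivariateGaussian 0 B).prod ((gaussianReal 0 1).prod (gaussianReal 0 1))).map
      (fun z => z.1 + (z.2.1 • toLp 2 a + z.2.2 • toLp 2 b)) =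
      multivariateGaussian 0 (B + (vecMulVec a a + vecMulVec b b)) := by
  have ha : (vecMulVec a a).PosSemidef := by simpa using posSemidef_vecMulVec_self_star a
  have hb : (vecMulVec b b).PosSemidef := by simpa using posSemidef_vecMulVec_self_star b
  have hm : Measurable (fun z : EuclideanSpace ℝ ι × ℝ × ℝ =>
      z.1 + (z.2.1 • toLp 2 a + z.2.2 • toLp 2 b)) := by fun_prop
  have := Measure.isProbabilityMeasure_map
    (μ := (multivariateGaussian 0 B).prod ((gaussianReal 0 1).prod (gaussianReal 0 1)))
    hm.aemeasurable
  apply Measure.ext_of_charFun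
  ext t
  rw [charFun_multivariateGaussian (hB.add (ha.add hb)), charFun_apply,
    integral_map hm.aemeasurable (by fun_prop)]
  have h1 : ∀ z : EuclideanSpace ℝ ι × ℝ × ℝ,
      Complex.exp ((inner ℝ (z.1 + (z.2.1 • toLp 2 a + z.2.2 • toLp 2 b)) t : ℝ) * Complex.I) =
      Complex.exp ((inner ℝ z.1 t : ℝ) * Complex.I) *
        (Complex.exp ((a ⬝ᵥ ofLp t : ℝ) * (z.2.1 : ℝ) * Complex.I) *
          Complex.exp ((b ⬝ᵥ ofLp t : ℝ) * (z.2.2 : ℝ) * Complex.I)) := by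
    intro z
    rw [← Complex.exp_add, ← Complex.exp_add, inner_add_left, inner_add_left,
      real_inner_smul_left, real_inner_smul_left, EuclideanSpace.inner_eq_star_dotProduct (toLp 2 a),
      EuclideanSpace.inner_eq_star_dotProduct (toLp 2 b)]
    simp only [star_trivial, dotProduct_comm (ofLp t)]
    congr 1
    push_cast
    ring
  simp_rw [h1]
  rw [integral_prod_mul (fun z : EuclideanSpace ℝ ι => Complex.exp ((inner ℝ z t : ℝ) * Complex.I))
    (fun y : ℝ × ℝ => Complex.exp ((a ⬝ᵥ ofLp t : ℝ) * (y.1 : ℝ) * Complex.I) *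
          Complex.exp ((b ⬝ᵥ ofLp t : ℝ) * (y.2 : ℝ) * Complex.I)),
    integral_prod_mul (fun y : ℝ => Complex.exp ((a ⬝ᵥ ofLp t : ℝ) * (y : ℝ) * Complex.I))
    (fun y : ℝ => Complex.exp ((b ⬝ᵥ ofLp t : ℝ) * (y : ℝ) * Complex.I)),
    ← charFun_apply_real, ← charFun_apply_real, ← charFun_apply, charFun_gaussianReal,
    charFun_gaussianReal, charFun_multivariateGaussian hB, ← Complex.exp_add, ← Complex.exp_add]
  congr 1
  simp [Matrix.add_mulVec, vecMulVec_mulVec, dotProduct_comm (ofLp t)]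
  ring

/-- A linear functional of a centred Gaussian vector is a centred Gaussian variable. -/
theorem map_dotProduct_multivariateGaussian {B : Matrix ι ι ℝ} (hB : B.PosSemidef)
    (u : ι → ℝ) :
    (multivariateGaussian 0 B).map (fun z => u ⬝ᵥ ofLp z) =
      gaussianReal 0 (u ⬝ᵥ B *ᵥ u).toNNReal := by
  have hm : Measurable (fun z : EuclideanSpace ℝ ι => u ⬝ᵥ ofLp z) := by
    apply Continuous.measurable
    fun_prop
  have := Measure.isProbabilityMeasure_map (μ := multivariateGaussian 0 B) hm.aemeasurable
  have h0 : 0 ≤ u ⬝ᵥ B *ᵥ u := by simpa using hB.dotProduct_mulVec_nonneg u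
  apply Measure.ext_of_charFun
  ext s
  have h1 : charFun ((multivariateGaussian 0 B).map (fun z => u ⬝ᵥ ofLp z)) s =
      charFun (multivariateGaussian 0 B) (s • toLp 2 u) := by
    rw [charFun_apply_real, integral_map hm.aemeasurable (by fun_prop), charFun_apply]
    congr 1
    ext z
    rw [real_inner_smul_right, EuclideanSpace.inner_eq_star_dotProduct]
    simp
  rw [h1, charFun_multivariateGaussian hB, charFun_gaussianReal, Real.coe_toNNReal _ h0]
  congr 1
  simp [Matrix.mulVec_smul]
  ring

theorem integrable_exp_dotProduct {B : Matrix ι ι ℝ} (hB : B.PosSemidef) (u : ι → ℝ) :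
    Integrable (fun z => Real.exp (u ⬝ᵥ ofLp z)) (multivariateGaussian 0 B) := by
  have hm : Measurable (fun z : EuclideanSpace ℝ ι => u ⬝ᵥ ofLp z) := by
    apply Continuous.measurable
    fun_prop
  have h := integrable_exp_mul_gaussianReal (μ := 0) (v := (u ⬝ᵥ B *ᵥ u).toNNReal) 1
  rw [← map_dotProduct_multivariateGaussian hB] at h
  simpa [Function.comp_def] using h.comp_measurable hm

/-- The moment generating function of a centred Gaussian vector. -/
theorem integral_exp_dotProduct {B : Matrix ι ι ℝ} (hB : B.PosSemidef) (u : ι → ℝ) :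
    ∫ z, Real.exp (u ⬝ᵥ ofLp z) ∂(multivariateGaussian 0 B) =
      Real.exp ((u ⬝ᵥ B *ᵥ u) / 2) := by
  have h0 : 0 ≤ u ⬝ᵥ B *ᵥ u := by simpa using hB.dotProduct_mulVec_nonneg u
  have h := mgf_gaussianReal (map_dotProduct_multivariateGaussian hB u) 1
  simpa [mgf, Real.coe_toNNReal _ h0] using h

theorem integrable_exp_eval {B : Matrix ι ι ℝ} (hB : B.PosSemidef) (i : ι) :
    Integrable (fun z => Real.exp (z i)) (multivariateGaussian 0 B) := by
  simpa using integrable_exp_dotProduct hB (Pi.single i 1)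

theorem integral_exp_eval {B : Matrix ι ι ℝ} (hB : B.PosSemidef) (i : ι) :
    ∫ z, Real.exp (z i) ∂(multivariateGaussian 0 B) = Real.exp (B i i / 2) := by
  simpa using integral_exp_dotProduct hB (Pi.single i 1)

theorem integrable_exp_eval_add {B : Matrix ι ι ℝ} (hB : B.PosSemidef) (i j : ι) :
    Integrable (fun z => Real.exp (z i + z j)) (multivariateGaussian 0 B) := by
  have h := integrable_exp_dotProduct hB (Pi.single i 1 + Pi.single j 1)
  simp only [add_dotProduct, single_dotProduct, one_mul] at h
  exact h

theorem integral_exp_eval_add {B : Matrix ι ι ℝ} (hB : B.PosSemidef) (i j : ι) :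
    ∫ z, Real.exp (z i + z j) ∂(multivariateGaussian 0 B) =
      Real.exp ((B i i + B j j + B i j + B j i) / 2) := by
  have h := integral_exp_dotProduct hB (Pi.single i 1 + Pi.single j 1)
  simp only [add_dotProduct, single_dotProduct, one_mul, Matrix.mulVec_add] at h
  rw [h]
  simp
  ring

end GaussianVectors

theorem vecMulVec_smul_single {ι : Type*} [DecidableEq ι] (c : ℝ) (i j : ι) :
    vecMulVec (c • Pi.single i 1 : ι → ℝ) (c • Pi.single j 1) = Matrix.single i j (c * c) := by
  ext k l
  simp only [vecMulVec_apply, Matrix.single_apply, Pi.smul_apply, Pi.single_apply, smul_eq_mul,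
    eq_comm (a := k), eq_comm (a := l)]
  by_cases hk : i = k <;> by_cases hl : j = l <;> simp [hk, hl]

/-! ### Slepian-type comparison by merging independent noises. -/

section Comparison

variable {ι : Type*} [Fintype ι]

/-- The absolute deviation from `1` of a weighted sum of exponentials. -/
noncomputable def expSumDev (p : ι → ℝ) (z : EuclideanSpace ℝ ι) : ℝ :=
  |∑ i, p i * Real.exp (z i) - 1|

theorem measurable_expSumDev (p : ι → ℝ) : Measurable (expSumDev p) := by
  unfold expSumDev
  fun_prop

/-- Convexity of |·|: the hypotheses force both `m₁` and `m₂` into the interval from `l` to `u`, and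
the two pairs have the same sum. -/
theorem abs_add_abs_le_of_spread {l u m₁ m₂ : ℝ} (h₁ : l ≤ m₁) (h₂ : l ≤ m₂)
    (h : m₁ + m₂ = l + u) : |m₁| + |m₂| ≤ |l| + |u| := by
  rcases abs_cases m₁ with a | a <;> rcases abs_cases m₂ with b | b <;>
    rcases abs_cases l with c | c <;> rcases abs_cases u with d | d <;> linarith

variable [DecidableEq ι]

theorem integrable_expSumDev (p : ι → ℝ) {B : Matrix ι ι ℝ} (hB : B.PosSemidef) :
    Integrable (expSumDev p) (multivariateGaussian 0 B) := by
  refine Integrable.abs (Integrable.sub ?_ (integrable_const _))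
  exact integrable_finsetSum _ fun i _ => (integrable_exp_eval hB i).const_mul _

theorem sum_exp_add_single_add_single (p : ι → ℝ) {i j : ι} (hij : i ≠ j) (x y : ℝ)
    (z : EuclideanSpace ℝ ι) :
    ∑ k, p k * Real.exp
      ((z + (x • toLp 2 (Pi.single i 1 : ι → ℝ) + y • toLp 2 (Pi.single j 1 : ι → ℝ))) k) =
    ∑ k, p k * Real.exp (z k) + (p i * Real.exp (z i) * (Real.exp x - 1) +
      p j * Real.exp (z j) * (Real.exp y - 1)) := by
  rw [← sub_eq_iff_eq_add', ← Finset.sum_sub_distrib, Fintype.sum_eq_add i j hij]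
  · simp [hij, hij.symm, Real.exp_add]
    ring
  · rintro k ⟨hi, hj⟩
    simp [hi, hj]

/-- Giving the same noise to two coordinates, instead of two independent copies of it, increases
the deviation on average over the exchange of the two copies. -/
theorem expSumDev_add_swap_le {p : ι → ℝ} (hp : ∀ i, 0 ≤ p i) {i j : ι} (hij : i ≠ j) (x y : ℝ)
    (z : EuclideanSpace ℝ ι) :
    expSumDev p (z + (x • toLp 2 (Pi.single i 1) + y • toLp 2 (Pi.single j 1))) +
      expSumDev p (z + (y • toLp 2 (Pi.single i 1) + x • toLp 2 (Pi.single j 1))) ≤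
    expSumDev p (z + (x • toLp 2 (Pi.single i 1) + x • toLp 2 (Pi.single j 1))) +
      expSumDev p (z + (y • toLp 2 (Pi.single i 1) + y • toLp 2 (Pi.single j 1))) := by
  simp only [expSumDev, sum_exp_add_single_add_single p hij]
  have hi := mul_nonneg (hp i) (Real.exp_pos (z i)).le
  have hj := mul_nonneg (hp j) (Real.exp_pos (z j)).le
  rcases le_total x y with h | h
  · have hi' := mul_le_mul_of_nonneg_left (Real.exp_le_exp.2 h) hi
    have hj' := mul_le_mul_of_nonneg_left (Real.exp_le_exp.2 h) hj
    apply abs_add_abs_le_of_spread <;> linarith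
  · have hi' := mul_le_mul_of_nonneg_left (Real.exp_le_exp.2 h) hi
    have hj' := mul_le_mul_of_nonneg_left (Real.exp_le_exp.2 h) hj
    rw [add_comm (|_|) (|_ + (_ + _) - 1|)]
    rw [add_comm (|_ + (_ * (Real.exp x - 1) + _ * (Real.exp x - 1)) - 1|)]
    apply abs_add_abs_le_of_spread <;> linarith

theorem integrable_expSumDev_add (p : ι → ℝ) {B : Matrix ι ι ℝ} (hB : B.PosSemidef)
    (a b : ι → ℝ) :
    Integrable (fun z : EuclideanSpace ℝ ι × ℝ × ℝ =>
        expSumDev p (z.1 + (z.2.1 • toLp 2 a + z.2.2 • toLp 2 b)))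
      ((multivariateGaussian 0 B).prod ((gaussianReal 0 1).prod (gaussianReal 0 1))) := by
  have ha : (vecMulVec a a).PosSemidef := by simpa using posSemidef_vecMulVec_self_star a
  have hb : (vecMulVec b b).PosSemidef := by simpa using posSemidef_vecMulVec_self_star b
  have h := integrable_expSumDev p (hB.add (ha.add hb))
  rw [← map_add_smul_add_smul hB a b] at h
  exact h.comp_measurable (by fun_prop)

theorem integral_expSumDev_add (p : ι → ℝ) {B : Matrix ι ι ℝ} (hB : B.PosSemidef)
    (a b : ι → ℝ) :
    ∫ z, expSumDev p (z.1 + (z.2.1 • toLp 2 a + z.2.2 • toLp 2 b))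
      ∂((multivariateGaussian 0 B).prod ((gaussianReal 0 1).prod (gaussianReal 0 1))) =
    ∫ z, expSumDev p z ∂(multivariateGaussian 0 (B + (vecMulVec a a + vecMulVec b b))) := by
  rw [← map_add_smul_add_smul hB a b, integral_map (by fun_prop)
    (measurable_expSumDev p).aestronglyMeasurable]

/-- Merging the independent noises, of variance `s ^ 2`, of two coordinates. -/
theorem integral_expSumDev_merge {p : ι → ℝ} (hp : ∀ i, 0 ≤ p i) {i j : ι} (hij : i ≠ j) (s : ℝ)
    {B : Matrix ι ι ℝ} (hB : B.PosSemidef) :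
    ∫ z, expSumDev p z ∂(multivariateGaussian 0 (B +
      (vecMulVec (s • Pi.single i 1) (s • Pi.single i 1) +
        vecMulVec (s • Pi.single j 1) (s • Pi.single j 1)))) ≤
    ∫ z, expSumDev p z ∂(multivariateGaussian 0 (B +
      vecMulVec (s • (Pi.single i 1 + Pi.single j 1)) (s • (Pi.single i 1 + Pi.single j 1)))) := by
  set a : ι → ℝ := s • Pi.single i 1
  set b : ι → ℝ := s • Pi.single j 1
  have h1 := integral_expSumDev_add p hB a b
  have h2 := integral_expSumDev_add p hB b a
  -- With directions (a + b, 0) both coordinates use the first noise, with (0, a + b) the second.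
  -- Integrating the pointwise swap inequality then gives twice the claim.
  have h3 := integral_expSumDev_add p hB (a + b) 0
  have h4 := integral_expSumDev_add p hB 0 (a + b)
  rw [add_comm (vecMulVec b b)] at h2
  simp only [vecMulVec_zero, add_zero, zero_add, toLp_zero, smul_zero] at h3 h4
  have hab : s • (Pi.single i 1 + Pi.single j 1) = a + b := by simp [a, b]
  rw [hab]
  have i1 := integrable_expSumDev_add p hB a b
  have i2 := integrable_expSumDev_add p hB b a
  have i3 := integrable_expSumDev_add p hB (a + b) 0
  have i4 := integrable_expSumDev_add p hB 0 (a + b)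
  simp only [add_zero, zero_add, toLp_zero, smul_zero] at i3 i4
  have key := integral_mono (i1.add i2) (i3.add i4) (fun z => by
    have h := expSumDev_add_swap_le hp hij (z.2.1 * s) (z.2.2 * s) z.1
    simp only [Pi.add_apply, a, b, toLp_add, toLp_smul, smul_add, smul_smul]
    rw [add_comm ((z.2.1 * s) • toLp 2 (Pi.single j 1))]
    exact h)
  simp only [Pi.add_apply] at key
  rw [integral_add i1 i2, integral_add i3 i4, h1, h2, h3, h4] at key
  linarith

/-- Pairs are merged one at a time, all other noises being absorbed into the base covariance. The
condition on `s` discards diagonal pairs, whose noises cannot be merged. -/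
theorem integral_expSumDev_merge_sum {p : ι → ℝ} (hp : ∀ i, 0 ≤ p i) (s : ι × ι → ℝ)
    (hs : ∀ i, s (i, i) = 0) (P : Finset (ι × ι)) :
    ∀ {B : Matrix ι ι ℝ}, B.PosSemidef →
    ∫ z, expSumDev p z ∂(multivariateGaussian 0 (B + ∑ q ∈ P,
      (vecMulVec (s q • Pi.single q.1 1) (s q • Pi.single q.1 1) +
        vecMulVec (s q • Pi.single q.2 1) (s q • Pi.single q.2 1)))) ≤
    ∫ z, expSumDev p z ∂(multivariateGaussian 0 (B + ∑ q ∈ P,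
      vecMulVec (s q • (Pi.single q.1 1 + Pi.single q.2 1))
        (s q • (Pi.single q.1 1 + Pi.single q.2 1)))) := by
  have hpsd : ∀ a : ι → ℝ, (vecMulVec a a).PosSemidef := fun a => by
    simpa using posSemidef_vecMulVec_self_star a
  induction P using Finset.induction_on with
  | empty => intro B _; simp
  | insert q P hq ih =>
    intro B hB
    rw [Finset.sum_insert hq, Finset.sum_insert hq, ← add_assoc]
    refine (ih (hB.add ((hpsd _).add (hpsd _)))).trans ?_
    rw [add_right_comm B]
    by_cases hne : q.1 = q.2
    · obtain ⟨i, j⟩ := q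
      obtain rfl : i = j := hne
      simp [hs]
    · have hB' : (B + ∑ q ∈ P, vecMulVec (s q • (Pi.single q.1 1 + Pi.single q.2 1))
          (s q • (Pi.single q.1 1 + Pi.single q.2 1))).PosSemidef :=
        hB.add (posSemidef_sum P fun q _ => hpsd _)
      have h := integral_expSumDev_merge hp hne (s q) hB'
      rw [add_assoc B (Finset.sum P _) (vecMulVec _ _), add_comm (Finset.sum P _) (vecMulVec _ _)] at h
      exact h

/-- The variance used up by the mergers: each unordered pair occurs in both orders, which explains
the halves. -/
theorem sum_single_diag {D : Matrix ι ι ℝ} (hD : ∀ i j, D i j = D j i) :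
    ∑ q : ι × ι, (Matrix.single q.1 q.1 (D q.1 q.2 / 2) + Matrix.single q.2 q.2 (D q.1 q.2 / 2)) =
      diagonal fun i => ∑ j, D i j := by
  ext i j
  rw [Finset.sum_add_distrib, Fintype.sum_prod_type_right, Fintype.sum_prod_type,
    Matrix.add_apply]
  simp only [Matrix.sum_apply, Matrix.single_apply, diagonal_apply]
  by_cases h : i = j
  · subst h
    simp only [and_self, Finset.sum_ite_eq', Finset.mem_univ, if_true, hD _ i]
    rw [← Finset.sum_add_distrib]
    simp
  · have h' : ∀ k, ¬(k = i ∧ k = j) := fun k hk => h (hk.1.symm.trans hk.2)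
    simp [h, h']

theorem sum_single_offDiag {D : Matrix ι ι ℝ} (hD : ∀ i j, D i j = D j i) :
    ∑ q : ι × ι, (Matrix.single q.1 q.2 (D q.1 q.2 / 2) + Matrix.single q.2 q.1 (D q.1 q.2 / 2)) =
      D := by
  have h := matrix_eq_sum_single ((1 / 2 : ℝ) • D)
  rw [Finset.sum_add_distrib, Fintype.sum_prod_type, Fintype.sum_prod_type_right]
  simp only [Matrix.smul_apply, smul_eq_mul, one_div_mul_eq_div] at h
  have h2 : ∑ y : ι, ∑ x : ι, Matrix.single y x (D x y / 2) =
      ∑ y : ι, ∑ x : ι, Matrix.single y x (D y x / 2) := by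
    simp_rw [hD]
  change _ + ∑ y : ι, ∑ x : ι, Matrix.single y x (D x y / 2) = _
  rw [h2]
  change (∑ y : ι, ∑ x : ι, Matrix.single y x (D y x / 2)) + _ = _
  rw [← h, ← add_smul]
  norm_num

/-- Increasing the off-diagonal covariances by a small amount, in the presence of an independent
noise of variance `η` on each coordinate. -/
theorem integral_expSumDev_add_small {p : ι → ℝ} (hp : ∀ i, 0 ≤ p i) {B D : Matrix ι ι ℝ}
    (hB : B.PosSemidef) (hD : ∀ i j, 0 ≤ D i j) (hDs : ∀ i j, D i j = D j i)
    (hD0 : ∀ i, D i i = 0) {η : ℝ} (hη : ∀ i, ∑ j, D i j ≤ η) :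
    ∫ z, expSumDev p z ∂(multivariateGaussian 0 (B + η • (1 : Matrix ι ι ℝ))) ≤
      ∫ z, expSumDev p z ∂(multivariateGaussian 0 (B + η • (1 : Matrix ι ι ℝ) + D)) := by
  -- Merging a noise of variance D i j / 2 for each of the ordered pairs (i, j) and (j, i) creates
  -- covariance D i j in total.
  set s : ι × ι → ℝ := fun q => Real.sqrt (D q.1 q.2 / 2) with hs
  have hss : ∀ q, s q * s q = D q.1 q.2 / 2 := fun q =>
    Real.mul_self_sqrt (by have := hD q.1 q.2; positivity)
  -- Coordinate i spends its row sum of `D` on mergers; the rest of its noise, nonnegative by `hη`,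
  -- remains in the base.
  have hB' : (B + (η • (1 : Matrix ι ι ℝ) - diagonal fun i => ∑ j, D i j)).PosSemidef := by
    refine hB.add ?_
    have : (η • (1 : Matrix ι ι ℝ) - diagonal fun i => ∑ j, D i j) =
        diagonal fun i => η - ∑ j, D i j := by
      rw [← diagonal_one, ← diagonal_smul, diagonal_sub]
      congr 1
      ext i
      simp
    rw [this, posSemidef_diagonal_iff]
    intro i
    linarith [hη i]
  have h := integral_expSumDev_merge_sum hp s (by simp [hs, hD0]) Finset.univ hB'
  have hfull : ∑ q : ι × ι, vecMulVec (s q • (Pi.single q.1 1 + Pi.single q.2 1 : ι → ℝ))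
      (s q • (Pi.single q.1 1 + Pi.single q.2 1)) = diagonal (fun i => ∑ j, D i j) + D := by
    conv_rhs => rw [← sum_single_diag hDs, ← sum_single_offDiag hDs, ← Finset.sum_add_distrib]
    refine Finset.sum_congr rfl fun q _ => ?_
    simp only [smul_add, add_vecMulVec, vecMulVec_add, vecMulVec_smul_single, hss,
      sum_single_offDiag hDs]
    abel
  rw [hfull] at h
  simp only [vecMulVec_smul_single, hss] at h
  rw [sum_single_diag hDs, ← add_assoc (B + _), add_assoc B, sub_add_cancel] at h
  exact h

/-- Comparison of Gaussian vectors with equal variances and ordered covariances, in the presence of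
an independent noise on each coordinate. -/
theorem integral_expSumDev_le_of_covariance_le {p : ι → ℝ} (hp : ∀ i, 0 ≤ p i)
    {A A' : Matrix ι ι ℝ} (hA : A.PosSemidef) (hA' : A'.PosSemidef)
    (hle : ∀ i j, A i j ≤ A' i j) (hdiag : ∀ i, A i i = A' i i) {η : ℝ} (hη : 0 < η) :
    ∫ z, expSumDev p z ∂(multivariateGaussian 0 (A + η • (1 : Matrix ι ι ℝ))) ≤
      ∫ z, expSumDev p z ∂(multivariateGaussian 0 (A' + η • (1 : Matrix ι ι ℝ))) := by
  -- The segment from `A` to `A'` is cut into `m` steps, each with row sums at most `η`. The same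
  -- noise serves every step, since a merger redistributes it without changing the variances.
  obtain ⟨m, hm⟩ := exists_nat_gt ((∑ i, ∑ j, (A' i j - A i j)) / η)
  have hrow : ∀ i, 0 ≤ ∑ j, (A' i j - A i j) := fun i =>
    Finset.sum_nonneg fun j _ => sub_nonneg.2 (hle i j)
  have hm0 : (0 : ℝ) < m := lt_of_le_of_lt
    (div_nonneg (Finset.sum_nonneg fun i _ => hrow i) hη.le) hm
  rw [div_lt_iff₀ hη] at hm
  have hstep : ∀ k : ℕ, k ≤ m →
      ∫ z, expSumDev p z ∂(multivariateGaussian 0 (A + η • (1 : Matrix ι ι ℝ))) ≤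
      ∫ z, expSumDev p z ∂(multivariateGaussian 0
        (A + ((k : ℝ) / m) • (A' - A) + η • (1 : Matrix ι ι ℝ))) := by
    intro k
    induction k with
    | zero => simp
    | succ k ih =>
      intro hk
      refine (ih (by omega)).trans ?_
      have hk1 : (k : ℝ) / m ≤ 1 := by
        rw [div_le_one hm0]
        exact_mod_cast (by omega : k ≤ m)
      have hB : (A + ((k : ℝ) / m) • (A' - A)).PosSemidef := by
        have : A + ((k : ℝ) / m) • (A' - A) =
            (1 - (k : ℝ) / m) • A + ((k : ℝ) / m) • A' := by
          rw [sub_smul, smul_sub, one_smul]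
          abel
        rw [this]
        exact (hA.smul (sub_nonneg.2 hk1)).add (hA'.smul (by positivity))
      have h := integral_expSumDev_add_small hp (D := (1 / (m : ℝ)) • (A' - A)) (η := η) hB
        (fun i j => mul_nonneg (by positivity) (sub_nonneg.2 (hle i j)))
        (fun i j => by
          have h1 := hA.isHermitian.apply i j
          have h2 := hA'.isHermitian.apply i j
          simp only [star_trivial] at h1 h2
          simp [h1, h2])
        (fun i => by simp [hdiag])
        (fun i => by
          simp only [Matrix.smul_apply, Matrix.sub_apply, smul_eq_mul, ← Finset.mul_sum]
          rw [one_div, inv_mul_le_iff₀ hm0]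
          exact (Finset.single_le_sum (fun i _ => hrow i) (Finset.mem_univ i)).trans hm.le)
      refine h.trans (le_of_eq ?_)
      congr 2
      rw [add_right_comm, add_assoc A, ← add_smul, ← add_div]
      push_cast
      rfl
  have h := hstep m le_rfl
  rw [div_self hm0.ne', one_smul, add_sub_cancel] at h
  exact h

/-- Adding an independent noise of variance `η` to each coordinate, with the corresponding
renormalization of the weights, increases the mean deviation. -/
theorem integral_expSumDev_le_add_noise (p : ι → ℝ) {B : Matrix ι ι ℝ} (hB : B.PosSemidef)
    {η : ℝ} (hη : 0 ≤ η) :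
    ∫ z, expSumDev p z ∂(multivariateGaussian 0 B) ≤
      ∫ z, expSumDev (fun i => p i * Real.exp (-η / 2)) z
        ∂(multivariateGaussian 0 (B + η • (1 : Matrix ι ι ℝ))) := by
  have hI : (η • (1 : Matrix ι ι ℝ)).PosSemidef := PosSemidef.one.smul hη
  set q : ι → ℝ := fun i => p i * Real.exp (-η / 2) with hq
  have hint := integrable_expSumDev q (hB.add hI)
  rw [← map_add_multivariateGaussian hB hI] at hint ⊢
  have hint' := hint.comp_measurable (by fun_prop)
  rw [integral_map (by fun_prop) (measurable_expSumDev q).aestronglyMeasurable,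
    integral_prod (fun z : EuclideanSpace ℝ ι × EuclideanSpace ℝ ι => expSumDev q (z.1 + z.2)) hint']
  refine integral_mono (integrable_expSumDev p hB) hint'.integral_prod_left fun z => ?_
  have hz : ∀ y : EuclideanSpace ℝ ι, expSumDev q (z + y) =
      ‖∑ i, q i * (Real.exp (z i) * Real.exp (y i)) - 1‖ := fun y => by
    simp [expSumDev, Real.exp_add]
  simp only [hz]
  -- Jensen over the noise y at fixed z: the factor exp(-η/2) in `q` makes the mean of `q i * exp (y
  -- i)` equal to `p i`.
  refine le_trans (le_of_eq ?_) (norm_integral_le_integral_norm _)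
  · have hi : ∀ i, Integrable (fun y : EuclideanSpace ℝ ι =>
        q i * (Real.exp (z i) * Real.exp (y i))) (multivariateGaussian 0 (η • 1)) := fun i =>
      ((integrable_exp_eval hI i).const_mul _).const_mul _
    rw [integral_sub (integrable_finsetSum _ fun i _ => hi i) (integrable_const _),
      integral_finsetSum _ fun i _ => hi i]
    simp only [integral_const_mul, integral_exp_eval hI]
    simp only [expSumDev, Real.norm_eq_abs]
    congr 2
    · refine Finset.sum_congr rfl fun i _ => ?_
      rw [hq, mul_comm (Real.exp (z i)), mul_assoc, ← mul_assoc (Real.exp _), ← Real.exp_add]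
      simp [neg_div]
    · simp

end Comparison

/-! ### Likelihood ratios, total variation and the symmetry reduction. -/

section ChangeOfMeasure

/-- The law `N(m, 1)` is absolutely continuous with respect to `N(0, 1)`. -/
theorem gaussianReal_eq_withDensity (m : ℝ) :
    gaussianReal m 1 = (gaussianReal 0 1).withDensity
      fun x => ENNReal.ofReal (Real.exp (m * x - m ^ 2 / 2)) := by
  rw [gaussianReal_of_var_ne_zero _ one_ne_zero, gaussianReal_of_var_ne_zero _ one_ne_zero,
    ← withDensity_mul _ (measurable_gaussianPDF 0 1) (by fun_prop)]
  congr 1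
  ext x
  simp only [Pi.mul_apply, gaussianPDF]
  rw [← ENNReal.ofReal_mul (gaussianPDFReal_nonneg _ _ _)]
  congr 1
  simp only [gaussianPDFReal, mul_assoc, ← Real.exp_add]
  congr 2
  push_cast
  ring

theorem integrable_exp_mul_sub (m : ℝ) :
    Integrable (fun x => Real.exp (m * x - m ^ 2 / 2)) (gaussianReal 0 1) := by
  simp_rw [Real.exp_sub]
  exact (integrable_exp_mul_gaussianReal m).div_const _

theorem integral_exp_mul_sub (m : ℝ) :
    ∫ x, Real.exp (m * x - m ^ 2 / 2) ∂(gaussianReal 0 1) = 1 := by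
  have h := mgf_gaussianReal (p := gaussianReal 0 1) (X := id) (μ := 0) (v := 1) (by simp) m
  simp only [mgf, id] at h
  simp_rw [Real.exp_sub]
  rw [integral_div, h, ← Real.exp_sub]
  simp

theorem gaussianReal_apply_eq_integral_exp (m : ℝ) {s : Set ℝ} (hs : MeasurableSet s) :
    gaussianReal m 1 s =
      ENNReal.ofReal (∫ x in s, Real.exp (m * x - m ^ 2 / 2) ∂(gaussianReal 0 1)) := by
  rw [gaussianReal_eq_withDensity, withDensity_apply _ hs, ofReal_integral_eq_lintegral_ofReal
    (integrable_exp_mul_sub m).integrableOn (Filter.Eventually.of_forall fun x => (Real.exp_pos _).le)]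

variable {n : ℕ}

instance isProbabilityMeasure_nullLaw : IsProbabilityMeasure (nullLaw n) := by
  unfold nullLaw
  infer_instance

theorem exp_sum_eq_prod (μ : ℝ) (S : Finset (Fin n)) (x : Fin n → ℝ) :
    Real.exp (μ * ∑ i ∈ S, x i - (S.card : ℝ) * μ ^ 2 / 2) =
      ∏ i, Real.exp ((if i ∈ S then μ else 0) * x i - (if i ∈ S then μ else 0) ^ 2 / 2) := by
  rw [← Real.exp_sum]
  congr 1
  have : ∀ i, (if i ∈ S then μ else 0) * x i - (if i ∈ S then μ else 0) ^ 2 / 2 =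
      if i ∈ S then μ * x i - μ ^ 2 / 2 else 0 := fun i => by split_ifs <;> simp
  simp_rw [this]
  rw [Finset.sum_ite_mem, Finset.univ_inter, Finset.sum_sub_distrib, Finset.mul_sum]
  simp
  ring

theorem integrable_exp_sum (μ : ℝ) (S : Finset (Fin n)) :
    Integrable (fun x => Real.exp (μ * ∑ i ∈ S, x i - (S.card : ℝ) * μ ^ 2 / 2)) (nullLaw n) := by
  simp_rw [exp_sum_eq_prod]
  exact Integrable.fintype_prod (f := fun i (y : ℝ) => Real.exp
    ((if i ∈ S then μ else 0) * y - (if i ∈ S then μ else 0) ^ 2 / 2))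
    fun i => integrable_exp_mul_sub _

/-- The density is a product over coordinates, so both measures agree on boxes, which determine a
product measure. -/
theorem law_eq_withDensity (μ : ℝ) (S : Finset (Fin n)) :
    law μ S = (nullLaw n).withDensity fun x =>
      ENNReal.ofReal (Real.exp (μ * ∑ i ∈ S, x i - (S.card : ℝ) * μ ^ 2 / 2)) := by
  refine Measure.pi_eq fun s hs => ?_
  rw [withDensity_apply _ (MeasurableSet.univ_pi hs), ← ofReal_integral_eq_lintegral_ofReal
    (integrable_exp_sum μ S).integrableOn (Filter.Eventually.of_forall fun x => (Real.exp_pos _).le)]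
  simp_rw [exp_sum_eq_prod]
  rw [nullLaw, Measure.restrict_pi_pi, integral_fintype_prod_eq_prod
    (f := fun i (y : ℝ) => Real.exp
      ((if i ∈ S then μ else 0) * y - (if i ∈ S then μ else 0) ^ 2 / 2)),
    ENNReal.ofReal_prod_of_nonneg fun i _ => integral_nonneg fun y => (Real.exp_pos _).le]
  exact Finset.prod_congr rfl fun i _ => (gaussianReal_apply_eq_integral_exp _ (hs i)).symm

theorem law_real_eq_integral (μ : ℝ) (S : Finset (Fin n)) {E : Set (Fin n → ℝ)}
    (hE : MeasurableSet E) :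
    (law μ S).real E =
      ∫ x in E, Real.exp (μ * ∑ i ∈ S, x i - (S.card : ℝ) * μ ^ 2 / 2) ∂(nullLaw n) := by
  rw [Measure.real, law_eq_withDensity, withDensity_apply _ hE,
    ← ofReal_integral_eq_lintegral_ofReal (integrable_exp_sum μ S).integrableOn
      (Filter.Eventually.of_forall fun x => (Real.exp_pos _).le), ENNReal.toReal_ofReal
      (integral_nonneg fun x => (Real.exp_pos _).le)]

theorem measurable_likelihoodRatio (C : Finset (Finset (Fin n))) (μ : ℝ) :
    Measurable (likelihoodRatio C μ) := by
  unfold likelihoodRatio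
  fun_prop

theorem integrable_likelihoodRatio (C : Finset (Finset (Fin n))) (μ : ℝ) :
    Integrable (likelihoodRatio C μ) (nullLaw n) :=
  (integrable_finsetSum _ fun S _ => integrable_exp_sum μ S).const_mul _

theorem measurable_optimalTest (C : Finset (Finset (Fin n))) (μ : ℝ) :
    Measurable (optimalTest C μ) :=
  Measurable.ite (measurableSet_lt measurable_const (measurable_likelihoodRatio C μ))
    measurable_const measurable_const

theorem integral_likelihoodRatio {C : Finset (Finset (Fin n))} (hC : C.Nonempty) (μ : ℝ) :
    ∫ x, likelihoodRatio C μ x ∂(nullLaw n) = 1 := by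
  have h1 : ∀ S : Finset (Fin n),
      ∫ x, Real.exp (μ * ∑ i ∈ S, x i - (S.card : ℝ) * μ ^ 2 / 2) ∂(nullLaw n) = 1 := fun S => by
    have h := law_real_eq_integral μ S MeasurableSet.univ
    have : IsProbabilityMeasure (law μ S) := by
      unfold law
      infer_instance
    rw [setIntegral_univ] at h
    rw [← h]
    simp
  have hc : (C.card : ℝ) ≠ 0 := by exact_mod_cast hC.card_pos.ne'
  unfold likelihoodRatio
  rw [integral_const_mul, integral_finsetSum _ fun S _ => integrable_exp_sum μ S]
  simp [h1, hc]

/-- The risk of any test is at least one minus the total variation distance between the null law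
and the mixture of the alternatives. -/
theorem one_sub_le_risk {A : Finset (Finset (Fin n))} (hA : A.Nonempty) (μ : ℝ)
    {f : (Fin n → ℝ) → Fin 2} (hf : Measurable f) :
    1 - (∫ x, |likelihoodRatio A μ x - 1| ∂(nullLaw n)) / 2 ≤ risk A μ f := by
  have hE1 : MeasurableSet {x | f x = 1} := hf (measurableSet_singleton _)
  have hE0 : MeasurableSet {x | f x = 0} := hf (measurableSet_singleton _)
  have hL := integrable_likelihoodRatio A μ
  have hI1 : Integrable (fun x => 1 + likelihoodRatio A μ x) (nullLaw n) :=
    (integrable_const _).add hL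
  have hI2 : Integrable (fun x => |likelihoodRatio A μ x - 1|) (nullLaw n) :=
    (hL.sub (integrable_const _)).abs
  have hrisk : risk A μ f = ∫ x, ({x | f x = 1}.indicator (fun _ => (1 : ℝ)) x +
      {x | f x = 0}.indicator (likelihoodRatio A μ) x) ∂(nullLaw n) := by
    rw [integral_add ((integrable_const _).indicator hE1) (hL.indicator hE0),
      integral_indicator hE1, integral_indicator hE0, risk]
    congr 1
    · simp
    · unfold likelihoodRatio
      rw [integral_const_mul, integral_finsetSum _ fun S _ => (integrable_exp_sum μ S).integrableOn]
      simp_rw [law_real_eq_integral μ _ hE0]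
  -- The integrand is min(1, L), whereas the risk integrates either 1 or L according to the decision
  -- of the test.
  have hlow : ∫ x, (1 + likelihoodRatio A μ x - |likelihoodRatio A μ x - 1|) / 2 ∂(nullLaw n) =
      1 - (∫ x, |likelihoodRatio A μ x - 1| ∂(nullLaw n)) / 2 := by
    rw [integral_div, integral_sub hI1 hI2, integral_add (integrable_const _) hL,
      integral_likelihoodRatio hA]
    simp
    ring
  rw [hrisk, ← hlow]
  refine integral_mono ((hI1.sub hI2).div_const _)
    (((integrable_const _).indicator hE1).add (hL.indicator hE0)) fun x => ?_
  have h01 : f x = 0 ∨ f x = 1 := by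
    generalize f x = y
    fin_cases y <;> simp
  rcases h01 with h | h <;> simp only [Set.indicator, Set.mem_ofPred_eq, h] <;> norm_num
  · linarith [neg_abs_le (likelihoodRatio A μ x - 1)]
  · linarith [le_abs_self (likelihoodRatio A μ x - 1)]

/-- Under symmetry the Bayes risk of a class is the risk of its optimal test over any subclass. -/
theorem optimalRisk_eq_risk {C A : Finset (Finset (Fin n))} {μ : ℝ} (hC : C.Nonempty)
    (hsymm : IsSymmetric C μ) (hAC : A ⊆ C) (hA : A.Nonempty) :
    optimalRisk C μ = risk A μ (optimalTest C μ) := by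
  obtain ⟨T, hT⟩ := hA
  have havg : ∀ B ⊆ C, B.Nonempty → (1 / (B.card : ℝ)) *
      ∑ S ∈ B, (law μ S).real {x | optimalTest C μ x = 0} =
      (law μ T).real {x | optimalTest C μ x = 0} := fun B hB hne => by
    have hc : (B.card : ℝ) ≠ 0 := by exact_mod_cast hne.card_pos.ne'
    rw [Finset.sum_congr rfl fun S hS => hsymm S (hB hS) T (hAC hT)]
    simp [hc]
  rw [optimalRisk, risk, risk, havg C subset_rfl hC, havg A hAC ⟨T, hT⟩]

/-- The covariance matrix of the log-likelihoods, as a Gram matrix. -/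
theorem indicator_mul_transpose (A : Finset (Finset (Fin n))) (μ : ℝ) :
    (Matrix.of fun (S : A) i => if i ∈ S.1 then μ else 0) *
      (Matrix.of fun (S : A) i => if i ∈ S.1 then μ else 0)ᵀ =
      Matrix.of fun S T : A => μ ^ 2 * ((S.1 ∩ T.1).card : ℝ) := by
  ext S T
  simp only [Matrix.mul_apply, Matrix.transpose_apply, Matrix.of_apply]
  simp only [mul_ite, ite_mul, zero_mul, mul_zero, ← ite_and, ← Finset.mem_inter]
  rw [Finset.sum_ite_mem]
  simp [Finset.inter_comm]
  ring

theorem posSemidef_overlap (A : Finset (Finset (Fin n))) (μ : ℝ) :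
    (Matrix.of fun S T : A => μ ^ 2 * ((S.1 ∩ T.1).card : ℝ)).PosSemidef := by
  rw [← indicator_mul_transpose]
  simpa using posSemidef_self_mul_conjTranspose
    (Matrix.of fun (S : A) i => if i ∈ S.1 then μ else 0)

/-- The mean deviation of the likelihood ratio, as a functional of a Gaussian vector. -/
theorem integral_abs_likelihoodRatio_sub_one {A : Finset (Finset (Fin n))} {K : ℕ}
    (hK : ∀ S ∈ A, S.card = K) (μ : ℝ) :
    ∫ x, |likelihoodRatio A μ x - 1| ∂(nullLaw n) =
      ∫ z, expSumDev (fun _ : A => 1 / (A.card : ℝ) * Real.exp (-((K : ℝ) * μ ^ 2 / 2))) z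
        ∂(multivariateGaussian 0
          (Matrix.of fun S T : A => μ ^ 2 * ((S.1 ∩ T.1).card : ℝ))) := by
  set V : Matrix A (Fin n) ℝ := Matrix.of fun S i => if i ∈ S.1 then μ else 0 with hV
  have hVV := indicator_mul_transpose A μ
  rw [← hV] at hVV
  have hm : Measurable (fun x : Fin n → ℝ => toLp 2 (V *ᵥ x)) := by
    apply Continuous.measurable
    fun_prop
  rw [← hVV, ← map_mulVec_pi_gaussianReal, integral_map hm.aemeasurable
    (measurable_expSumDev _).aestronglyMeasurable]
  refine integral_congr_ae (Filter.Eventually.of_forall fun x => ?_)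
  simp only [expSumDev, likelihoodRatio]
  rw [← Finset.sum_coe_sort, Finset.mul_sum]
  congr 2
  refine Finset.sum_congr rfl fun S _ => ?_
  have : (V *ᵥ x) S = μ * ∑ i ∈ S.1, x i := by
    simp [mulVec, dotProduct, hV, Finset.mul_sum, ite_mul, Finset.sum_ite_mem]
  rw [this, hK _ S.2, sub_eq_add_neg, Real.exp_add]
  ring

end ChangeOfMeasure

/-! ### Numerical bounds. -/

section Numerics

/-- With y = x²/2, exp(-y) ≤ 1 - y + y²/2 because exp(y) ≥ 1 + y + y²/2 and the product of the two
quadratics is 1 + y⁴/4. The bound is then integrated. -/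
theorem gaussianReal_real_Ioc_le {b : ℝ} (hb : 0 ≤ b) :
    (gaussianReal 0 1).real (Set.Ioc (-b) b) ≤
      2 * (Real.sqrt (2 * Real.pi))⁻¹ * (b - b ^ 3 / 6 + b ^ 5 / 40) := by
  have hpt : ∀ x : ℝ, gaussianPDFReal 0 1 x ≤
      (Real.sqrt (2 * Real.pi))⁻¹ * (1 - x ^ 2 / 2 + x ^ 4 / 8) := by
    intro x
    simp only [gaussianPDFReal, NNReal.coe_one, mul_one, sub_zero]
    refine mul_le_mul_of_nonneg_left ?_ (by positivity)
    have h := Real.quadratic_le_exp_of_nonneg (x := x ^ 2 / 2) (by positivity)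
    rw [neg_div, Real.exp_neg, inv_le_comm₀ (Real.exp_pos _) (by nlinarith [sq_nonneg (x ^ 2 / 2 - 1)])]
    refine le_trans ?_ h
    rw [inv_le_iff_one_le_mul₀ (by nlinarith [sq_nonneg (x ^ 2 / 2 - 1)])]
    nlinarith [sq_nonneg (x ^ 2 * x ^ 2)]
  rw [Measure.real, gaussianReal_apply_eq_integral _ one_ne_zero,
    ENNReal.toReal_ofReal (integral_nonneg fun x => gaussianPDFReal_nonneg _ _ _),
    ← intervalIntegral.integral_of_le (by linarith)]
  refine (intervalIntegral.integral_mono_on (by linarith)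
    (integrable_gaussianPDFReal 0 1).intervalIntegrable
    (Continuous.intervalIntegrable (by fun_prop) _ _) fun x _ => hpt x).trans (le_of_eq ?_)
  rw [intervalIntegral.integral_const_mul, intervalIntegral.integral_add
    (Continuous.intervalIntegrable (by fun_prop) _ _)
    (Continuous.intervalIntegrable (by fun_prop) _ _), intervalIntegral.integral_sub
    (Continuous.intervalIntegrable (by fun_prop) _ _)
    (Continuous.intervalIntegrable (by fun_prop) _ _), intervalIntegral.integral_div,
    intervalIntegral.integral_div, integral_pow, integral_pow, intervalIntegral.integral_const]
  simp
  ring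

theorem gaussianReal_real_Ioc_le_of_le {b : ℝ} (hb : b ≤ 0.5755) :
    (gaussianReal 0 1).real (Set.Ioc (-b) b) ≤ 0.4351 := by
  refine (measureReal_mono (Set.Ioc_subset_Ioc (neg_le_neg hb) hb)).trans ?_
  refine (gaussianReal_real_Ioc_le (by norm_num)).trans ?_
  have hs : (2.50662 : ℝ) ≤ Real.sqrt (2 * Real.pi) := by
    apply Real.le_sqrt_of_sq_le
    have := Real.pi_gt_d6
    norm_num at this ⊢
    linarith
  have hi : (Real.sqrt (2 * Real.pi))⁻¹ ≤ 2.50662⁻¹ := inv_anti₀ (by norm_num) hs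
  calc _ ≤ 2 * (2.50662 : ℝ)⁻¹ * (0.5755 - 0.5755 ^ 3 / 6 + 0.5755 ^ 5 / 40) := by gcongr
    _ ≤ 0.4351 := by norm_num

theorem eight_mul_log_le : 8 * Real.log (2 / Real.sqrt 3) ≤ 1.151 := by
  rw [Real.log_div (by norm_num) (by positivity), Real.log_sqrt (by norm_num)]
  have h : Real.log (4 / 3) ≤ 0.28775 := by
    rw [Real.log_le_iff_le_exp (by norm_num)]
    have := Real.sum_le_exp_of_nonneg (x := 0.28775) (by norm_num) 6
    refine le_trans ?_ this
    simp only [Finset.sum_range_succ, Finset.sum_range_zero, Nat.factorial]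
    norm_num
  have h4 : Real.log (4 / 3) = 2 * Real.log 2 - Real.log 3 := by
    rw [Real.log_div (by norm_num) (by norm_num), show (4 : ℝ) = 2 ^ 2 by norm_num, Real.log_pow]
    norm_num
  linarith

/-- The exponent is 0.01 - 1.151², that is η - a² for the largest a; 0.1297 is the allowance for E|V
- 1|. -/
theorem exp_neg_le : Real.exp (-1.314801) ≤ 16 * 0.1297 ^ 2 := by
  rw [Real.exp_neg, inv_le_comm₀ (Real.exp_pos _) (by norm_num)]
  have := Real.sum_le_exp_of_nonneg (x := 1.314801) (by norm_num) 10
  refine le_trans ?_ this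
  simp only [Finset.sum_range_succ, Finset.sum_range_zero, Nat.factorial]
  norm_num

end Numerics

/-! ### Mean deviation when all covariances are equal. -/

section ProductForm

/-- U = exp(aX - a²/2) is the density of N(a, 1) against N(0, 1) and exceeds 1 exactly when X > a/2.
As E U = 1, E|U - 1| = 2E(1 - U)₊ = 2(P(X ≤ a/2) - P(X + a ≤ a/2)). -/
theorem integral_abs_exp_sub_one_eq {a : ℝ} (ha : 0 < a) :
    ∫ x, |Real.exp (a * x - a ^ 2 / 2) - 1| ∂(gaussianReal 0 1) =
      2 * (gaussianReal 0 1).real (Set.Ioc (-(a / 2)) (a / 2)) := by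
  have hU := integrable_exp_mul_sub a
  have hU1 : Integrable (fun x => 1 - Real.exp (a * x - a ^ 2 / 2)) (gaussianReal 0 1) :=
    (integrable_const _).sub hU
  have hpt : ∀ x : ℝ, |Real.exp (a * x - a ^ 2 / 2) - 1| = (Real.exp (a * x - a ^ 2 / 2) - 1) +
      2 * (Set.Iic (a / 2)).indicator (fun x => 1 - Real.exp (a * x - a ^ 2 / 2)) x := by
    intro x
    by_cases h : x ≤ a / 2
    · rw [Set.indicator_of_mem (by exact h), abs_of_nonpos]
      · ring
      · rw [sub_nonpos, Real.exp_le_one_iff]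
        nlinarith
    · rw [Set.indicator_of_notMem (by exact h), abs_of_nonneg]
      · ring
      · rw [sub_nonneg, Real.one_le_exp_iff]
        nlinarith
  have hshift : ∫ x in Set.Iic (a / 2), Real.exp (a * x - a ^ 2 / 2) ∂(gaussianReal 0 1) =
      (gaussianReal 0 1).real (Set.Iic (-(a / 2))) := by
    have h1 := gaussianReal_apply_eq_integral_exp a (measurableSet_Iic (a := a / 2))
    have h2 := gaussianReal_map_add_const (μ := 0) (v := 1) a
    rw [zero_add] at h2
    rw [← h2, Measure.map_apply (by fun_prop) measurableSet_Iic] at h1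
    rw [Measure.real, show Set.Iic (-(a / 2)) = (fun x => x + a) ⁻¹' Set.Iic (a / 2) by
      ext x; simp only [Set.mem_Iic, Set.mem_preimage]; constructor <;> intro h <;> linarith, h1,
      ENNReal.toReal_ofReal (integral_nonneg fun x => (Real.exp_pos _).le)]
  have hU2 : Integrable (fun x => Real.exp (a * x - a ^ 2 / 2) - 1) (gaussianReal 0 1) :=
    hU.sub (integrable_const _)
  simp_rw [hpt]
  rw [integral_add hU2 ((hU1.indicator measurableSet_Iic).const_mul _),
    integral_sub hU (integrable_const _), integral_exp_mul_sub, integral_const_mul,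
    integral_indicator measurableSet_Iic,
    integral_sub (integrable_const _).integrableOn hU.integrableOn, hshift]
  have hset : Set.Ioc (-(a / 2)) (a / 2) = Set.Iic (a / 2) \ Set.Iic (-(a / 2)) := by
    ext x
    simp [and_comm]
  rw [hset, measureReal_sdiff (Set.Iic_subset_Iic.2 (by linarith)) measurableSet_Iic]
  simp

variable {ι : Type*} [Fintype ι] [DecidableEq ι] [Nonempty ι]

/-- The mean deviation of an average of `M` independent normalized log-normal variables. -/
theorem integral_expSumDev_indep_le {r c : ℝ} (hr : 0 ≤ r) (hc : 0 < c) :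
    ∫ z, expSumDev (fun _ : ι => 1 / (Fintype.card ι : ℝ) * Real.exp (-(r / 2))) z
      ∂(multivariateGaussian 0 (r • (1 : Matrix ι ι ℝ))) ≤
      ((Real.exp r - 1) / Fintype.card ι / c + c) / 2 := by
  have hI : (r • (1 : Matrix ι ι ℝ)).PosSemidef := PosSemidef.one.smul hr
  have hM : (Fintype.card ι : ℝ) ≠ 0 := by exact_mod_cast Fintype.card_ne_zero
  set p : ℝ := 1 / (Fintype.card ι : ℝ) * Real.exp (-(r / 2)) with hp
  have hsq : ∀ z : EuclideanSpace ℝ ι, (∑ i, p * Real.exp (z i) - 1) ^ 2 =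
      (∑ i, ∑ j, p ^ 2 * Real.exp (z i + z j)) - 2 * ∑ i, p * Real.exp (z i) + 1 := by
    intro z
    have : ∑ i, ∑ j, p ^ 2 * Real.exp (z i + z j) = (∑ i, p * Real.exp (z i)) ^ 2 := by
      rw [pow_two (∑ i, _), Finset.sum_mul_sum]
      refine Finset.sum_congr rfl fun i _ => Finset.sum_congr rfl fun j _ => ?_
      rw [Real.exp_add]
      ring
    rw [this]
    ring
  have i1 : Integrable (fun z : EuclideanSpace ℝ ι => ∑ i, p * Real.exp (z i))
      (multivariateGaussian 0 (r • 1)) :=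
    integrable_finsetSum _ fun i _ => (integrable_exp_eval hI i).const_mul _
  have i2' : ∀ i, Integrable (fun z : EuclideanSpace ℝ ι => ∑ j, p ^ 2 * Real.exp (z i + z j))
      (multivariateGaussian 0 (r • 1)) := fun i =>
    integrable_finsetSum _ fun j _ => (integrable_exp_eval_add hI i j).const_mul _
  have i2 : Integrable (fun z : EuclideanSpace ℝ ι => ∑ i, ∑ j, p ^ 2 * Real.exp (z i + z j))
      (multivariateGaussian 0 (r • 1)) := integrable_finsetSum _ fun i _ => i2' i
  have i4 : Integrable (fun z : EuclideanSpace ℝ ι =>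
      (∑ i, ∑ j, p ^ 2 * Real.exp (z i + z j)) - 2 * ∑ i, p * Real.exp (z i))
      (multivariateGaussian 0 (r • 1)) := i2.sub (i1.const_mul 2)
  have i3 : Integrable (fun z : EuclideanSpace ℝ ι => (∑ i, p * Real.exp (z i) - 1) ^ 2)
      (multivariateGaussian 0 (r • 1)) := by
    simp_rw [hsq]
    exact i4.add (integrable_const _)
  have e1 : ∫ z, ∑ i, p * Real.exp (z i) ∂(multivariateGaussian 0 (r • (1 : Matrix ι ι ℝ))) = 1 := by
    rw [integral_finsetSum _ fun i _ => (integrable_exp_eval hI i).const_mul _]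
    simp_rw [integral_const_mul, integral_exp_eval hI]
    simp only [Matrix.smul_apply, Matrix.one_apply_eq, smul_eq_mul, mul_one, Finset.sum_const,
      Finset.card_univ, nsmul_eq_mul, hp]
    rw [mul_assoc, ← Real.exp_add, neg_add_cancel, Real.exp_zero]
    field_simp
  have e2 : ∫ z, ∑ i, ∑ j, p ^ 2 * Real.exp (z i + z j)
      ∂(multivariateGaussian 0 (r • (1 : Matrix ι ι ℝ))) =
      1 + (Real.exp r - 1) / Fintype.card ι := by
    rw [integral_finsetSum _ fun i _ => i2' i]
    have hterm : ∀ i j : ι, ∫ z, p ^ 2 * Real.exp (z i + z j)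
        ∂(multivariateGaussian 0 (r • (1 : Matrix ι ι ℝ))) =
        (1 / (Fintype.card ι : ℝ)) ^ 2 * (1 + if i = j then Real.exp r - 1 else 0) := by
      intro i j
      rw [integral_const_mul, integral_exp_eval_add hI, hp, mul_pow, ← Real.exp_nat_mul, mul_assoc,
        ← Real.exp_add]
      congr 1
      by_cases h : i = j
      · subst h
        simp
        ring_nf
      · simp [h, Ne.symm h]
        ring_nf
    have hrow : ∀ i : ι, ∫ z, ∑ j, p ^ 2 * Real.exp (z i + z j)
        ∂(multivariateGaussian 0 (r • (1 : Matrix ι ι ℝ))) =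
        (1 / (Fintype.card ι : ℝ)) ^ 2 * (Fintype.card ι + (Real.exp r - 1)) := by
      intro i
      rw [integral_finsetSum _ fun j _ => (integrable_exp_eval_add hI i j).const_mul _]
      simp_rw [hterm]
      rw [← Finset.mul_sum, Finset.sum_add_distrib]
      simp
    simp_rw [hrow]
    simp
    field_simp
  have hvar : ∫ z, (∑ i, p * Real.exp (z i) - 1) ^ 2
      ∂(multivariateGaussian 0 (r • (1 : Matrix ι ι ℝ))) = (Real.exp r - 1) / Fintype.card ι := by
    simp_rw [hsq]
    rw [integral_add i4 (integrable_const _),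
      integral_sub i2 (i1.const_mul 2), integral_const_mul, e1, e2]
    simp
    ring
  -- AM-GM in place of Cauchy–Schwarz: |w| ≤ (w²/c + c)/2, leaving only the variance to compute.
  have hle : ∀ z : EuclideanSpace ℝ ι, expSumDev (fun _ : ι => p) z ≤
      ((∑ i, p * Real.exp (z i) - 1) ^ 2 / c + c) / 2 := by
    intro z
    rw [expSumDev, ← sq_abs]
    generalize |∑ i, p * Real.exp (z i) - 1| = w
    have : 0 ≤ (w - c) ^ 2 / c := by positivity
    have h2 : (w - c) ^ 2 / c = w ^ 2 / c - 2 * w + c := by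
      field_simp
      ring
    linarith
  refine (integral_mono (integrable_expSumDev _ hI)
    (((i3.div_const c).add (integrable_const c)).div_const 2) hle).trans (le_of_eq ?_)
  simp only [Pi.add_apply]
  rw [integral_div, integral_add (i3.div_const c) (integrable_const c), integral_div, hvar]
  simp

/-- The mean deviation for the covariance `a² J + r I`. -/
theorem integral_expSumDev_common_le {a r c : ℝ} (ha : 0 < a) (hr : 0 ≤ r) (hc : 0 < c) :
    ∫ z, expSumDev (fun _ : ι => 1 / (Fintype.card ι : ℝ) * Real.exp (-((a ^ 2 + r) / 2))) z
      ∂(multivariateGaussian 0 (r • (1 : Matrix ι ι ℝ) +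
        vecMulVec (fun _ => a) (fun _ => a))) ≤
      2 * (gaussianReal 0 1).real (Set.Ioc (-(a / 2)) (a / 2)) +
        ((Real.exp r - 1) / Fintype.card ι / c + c) / 2 := by
  have hI : (r • (1 : Matrix ι ι ℝ)).PosSemidef := PosSemidef.one.smul hr
  set q : ι → ℝ := fun _ : ι => 1 / (Fintype.card ι : ℝ) * Real.exp (-((a ^ 2 + r) / 2)) with hq
  set p : ι → ℝ := fun _ : ι => 1 / (Fintype.card ι : ℝ) * Real.exp (-(r / 2)) with hp
  have h := integral_expSumDev_add q hI (fun _ => a) 0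
  have hi := integrable_expSumDev_add q hI (fun _ => a) 0
  simp only [vecMulVec_zero, add_zero, toLp_zero, smul_zero] at h hi
  rw [← h]
  -- |UV - 1| ≤ U|V - 1| + |U - 1|; independence and E U = 1 then split the integral.
  have hle : ∀ z : EuclideanSpace ℝ ι × ℝ × ℝ, expSumDev q (z.1 + z.2.1 • toLp 2 (fun _ => a)) ≤
      expSumDev p z.1 * Real.exp (a * z.2.1 - a ^ 2 / 2) +
        |Real.exp (a * z.2.1 - a ^ 2 / 2) - 1| := by
    intro z
    set U := Real.exp (a * z.2.1 - a ^ 2 / 2) with hU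
    have hfac : ∑ i, q i * Real.exp ((z.1 + z.2.1 • toLp 2 (fun _ : ι => a)) i) =
        U * ∑ i, p i * Real.exp (z.1 i) := by
      rw [Finset.mul_sum]
      refine Finset.sum_congr rfl fun i _ => ?_
      simp only [hq, hp, hU, PiLp.add_apply, PiLp.smul_apply, smul_eq_mul]
      rw [mul_left_comm, mul_assoc, mul_assoc, ← Real.exp_add, ← Real.exp_add, ← Real.exp_add]
      ring_nf
    have hUp : 0 < U := Real.exp_pos _
    simp only [expSumDev]
    rw [hfac, ← abs_of_pos hUp, ← abs_mul, abs_of_pos hUp]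
    refine le_trans (le_of_eq ?_) (abs_add_le _ _)
    congr 1
    ring
  have j1 : Integrable (fun y : ℝ × ℝ => Real.exp (a * y.1 - a ^ 2 / 2))
      ((gaussianReal 0 1).prod (gaussianReal 0 1)) := (integrable_exp_mul_sub a).comp_fst _
  have j2 : Integrable (fun z : EuclideanSpace ℝ ι × ℝ × ℝ =>
      expSumDev p z.1 * Real.exp (a * z.2.1 - a ^ 2 / 2))
      ((multivariateGaussian 0 (r • (1 : Matrix ι ι ℝ))).prod
        ((gaussianReal 0 1).prod (gaussianReal 0 1))) := (integrable_expSumDev p hI).mul_prod j1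
  have j3 : Integrable (fun z : EuclideanSpace ℝ ι × ℝ × ℝ =>
      |Real.exp (a * z.2.1 - a ^ 2 / 2) - 1|)
      ((multivariateGaussian 0 (r • (1 : Matrix ι ι ℝ))).prod
        ((gaussianReal 0 1).prod (gaussianReal 0 1))) :=
    (j1.sub (integrable_const _)).abs.comp_snd _
  refine (integral_mono hi (j2.add j3) hle).trans ?_
  simp only [Pi.add_apply]
  rw [integral_add j2 j3, integral_prod_mul (expSumDev p)
    (fun y : ℝ × ℝ => Real.exp (a * y.1 - a ^ 2 / 2)),
    integral_fun_fst (fun x => Real.exp (a * x - a ^ 2 / 2)), integral_exp_mul_sub,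
    integral_fun_snd (fun y : ℝ × ℝ => |Real.exp (a * y.1 - a ^ 2 / 2) - 1|),
    integral_fun_fst (fun x => |Real.exp (a * x - a ^ 2 / 2) - 1|),
    integral_abs_exp_sub_one_eq ha]
  have := integral_expSumDev_indep_le (ι := ι) hr hc
  simp only [probReal_univ, one_smul, mul_one]
  linarith

end ProductForm

/-! ### Packings and the comparison applied to them. -/

section Packing

variable {n : ℕ}

theorem exists_isSeparated_card_eq (C : Finset (Finset (Fin n))) (t : ℝ) :
    ∃ A ⊆ C, IsSeparated t A ∧ A.card = packingNumber C t := by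
  classical
  obtain ⟨A, hA, h⟩ := Finset.exists_mem_eq_sup
    (C.powerset.filter (fun A => IsSeparated t A))
    ⟨∅, Finset.mem_filter.2 ⟨Finset.empty_mem_powerset C, by simp [IsSeparated]⟩⟩ Finset.card
  rw [Finset.mem_filter, Finset.mem_powerset] at hA
  refine ⟨A, hA.1, hA.2, ?_⟩
  rw [packingNumber, ← h]

/-- For sets of size K, |S △ T| = 2K - 2|S ∩ T|. -/
theorem card_inter_le_of_le_canonicalDist {S T : Finset (Fin n)} {K : ℕ} (hS : S.card = K)
    (hT : T.card = K) {t : ℝ} (ht : 0 ≤ t) (h : t ≤ canonicalDist S T) :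
    ((S ∩ T).card : ℝ) ≤ K - t ^ 2 / 2 := by
  have h1 : t ^ 2 ≤ ((symmDiff S T).card : ℝ) := by
    rw [← Real.sq_sqrt (Nat.cast_nonneg (symmDiff S T).card)]
    exact pow_le_pow_left₀ ht h 2
  have h2 : (symmDiff S T).card = (S \ T).card + (T \ S).card := by
    rw [symmDiff_def, Finset.sup_eq_union]
    exact Finset.card_union_of_disjoint disjoint_sdiff_sdiff
  have h3 := Finset.card_sdiff_add_card_inter S T
  have h4 := Finset.card_sdiff_add_card_inter T S
  rw [Finset.inter_comm] at h4
  have h5 : ((symmDiff S T).card : ℝ) + 2 * (S ∩ T).card = 2 * K := by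
    exact_mod_cast (by omega : (symmDiff S T).card + 2 * (S ∩ T).card = 2 * K)
  linarith

/-- If the overlaps of the members of `A` are small, the mean deviation of the likelihood ratio is
controlled by the one of a Gaussian vector with covariance `a² J + s² I`. -/
theorem integral_abs_likelihoodRatio_sub_one_le {A : Finset (Finset (Fin n))} (hA : A.Nonempty)
    {K : ℕ} (hK : ∀ S ∈ A, S.card = K) {μ a r η c : ℝ} (ha : 0 < a)
    (haK : a ^ 2 ≤ μ ^ 2 * K) (hη : 0 < η) (hr : r = μ ^ 2 * K - a ^ 2 + η)
    (hov : ∀ S ∈ A, ∀ T ∈ A, S ≠ T → μ ^ 2 * ((S ∩ T).card : ℝ) ≤ a ^ 2) (hc : 0 < c) :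
    ∫ x, |likelihoodRatio A μ x - 1| ∂(nullLaw n) ≤
      2 * (gaussianReal 0 1).real (Set.Ioc (-(a / 2)) (a / 2)) +
        ((Real.exp r - 1) / A.card / c + c) / 2 := by
  have : Nonempty A := hA.to_subtype
  rw [integral_abs_likelihoodRatio_sub_one hK]
  refine (integral_expSumDev_le_add_noise _ (posSemidef_overlap A μ) hη.le).trans ?_
  set s2 := μ ^ 2 * K - a ^ 2 with hs2
  have hs0 : 0 ≤ s2 := sub_nonneg.2 haK
  have hpsd : (s2 • (1 : Matrix A A ℝ) + vecMulVec (fun _ => a) (fun _ => a)).PosSemidef :=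
    (PosSemidef.one.smul hs0).add (by simpa using posSemidef_vecMulVec_self_star (fun _ : A => a))
  have hdiag : ∀ S : A, (Matrix.of fun S T : A => μ ^ 2 * ((S.1 ∩ T.1).card : ℝ)) S S =
      (s2 • (1 : Matrix A A ℝ) + vecMulVec (fun _ => a) (fun _ => a) : Matrix A A ℝ) S S := by
    intro S
    simp [vecMulVec_apply, hs2, hK _ S.2]
    ring
  refine (integral_expSumDev_le_of_covariance_le (fun i => by positivity)
    (posSemidef_overlap A μ) hpsd (fun S T => ?_) hdiag hη).trans ?_
  · by_cases h : S = T
    · subst h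
      exact (hdiag S).le
    · have := hov S.1 S.2 T.1 T.2 (fun h' => h (Subtype.ext h'))
      simp only [Matrix.of_apply, Matrix.add_apply, Matrix.smul_apply, Matrix.one_apply_ne h,
        vecMulVec_apply, smul_zero, zero_add]
      linarith
  · have h := integral_expSumDev_common_le (ι := A) ha (r := r) (by linarith) hc
    rw [Fintype.card_coe] at h
    refine le_trans (le_of_eq ?_) h
    congr 2
    · rw [add_right_comm, ← add_smul, hr]
    · ext z
      congr 1
      ext S
      have he : -((K : ℝ) * μ ^ 2 / 2) + -η / 2 = -((a ^ 2 + r) / 2) := by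
        rw [hr, hs2]
        ring
      rw [mul_assoc, ← Real.exp_add, he]

end Packing

end CombTest

/-! ### Choice of constants and conclusion. -/

open CombTest

theorem mainTheorem4 (n K : ℕ) (C : Finset (Finset (Fin n))) (hC : C.Nonempty)
    (hK : ∀ S ∈ C, S.card = K) (μ : ℝ) (hμ : 0 < μ) (hsymm : CombTest.IsSymmetric C μ)
    (t : ℝ) (ht0 : 0 ≤ t) (ht : t ≤ Real.sqrt (2 * (K : ℝ)))
    (h1 : μ ≤ Real.sqrt (Real.log ((CombTest.packingNumber C t : ℝ) / 16) / (K : ℝ)))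
    (h2 : t < Real.sqrt (2 * (K : ℝ)) →
      μ ≤ 8 * Real.log (2 / Real.sqrt 3) / Real.sqrt ((K : ℝ) - t ^ 2 / 2)) :
    1 / 2 ≤ CombTest.optimalRisk C μ := by
  obtain ⟨A, hAC, hsep, hcard⟩ := exists_isSeparated_card_eq C t
  rw [← hcard] at h1
  -- Since μ > 0, `h1` rules out the default value 0 of the square root and of division by zero;
  -- hence K > 0 and M > 16.
  have hq : 0 < Real.log ((A.card : ℝ) / 16) / K := Real.sqrt_pos.1 (hμ.trans_le h1)
  have hK0 : (0 : ℝ) < K := by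
    refine (Nat.cast_nonneg K).lt_of_ne fun h => ?_
    rw [← h, div_zero] at hq
    exact hq.false
  have hlog : 0 < Real.log ((A.card : ℝ) / 16) := by
    rwa [div_pos_iff_of_pos_right hK0] at hq
  have hM : (16 : ℝ) < A.card := by
    by_contra! h
    exact hlog.not_ge (Real.log_nonpos (by positivity) (by linarith))
  have hA : A.Nonempty := Finset.card_pos.1 (by exact_mod_cast (by linarith : (0 : ℝ) < A.card))
  have hexp : Real.exp (μ ^ 2 * K) ≤ A.card / 16 := by
    rw [← Real.le_log_iff_exp_le (by linarith), ← le_div_iff₀ hK0]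
    exact (Real.le_sqrt hμ.le hq.le).1 h1
  have hov1 : ∀ S ∈ A, ∀ T ∈ A, S ≠ T → μ ^ 2 * ((S ∩ T).card : ℝ) ≤ 1.151 ^ 2 := by
    intro S hS T hT hne
    have hle := card_inter_le_of_le_canonicalDist (hK S (hAC hS)) (hK T (hAC hT)) ht0
      (hsep S hS T hT hne)
    refine (mul_le_mul_of_nonneg_left hle (sq_nonneg μ)).trans ?_
    rcases ht.lt_or_eq with h | h
    · have hpos : 0 < (K : ℝ) - t ^ 2 / 2 := by
        have := (Real.lt_sqrt ht0).1 h
        linarith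
      have hle2 := h2 h
      rw [le_div_iff₀ (Real.sqrt_pos.2 hpos)] at hle2
      calc μ ^ 2 * ((K : ℝ) - t ^ 2 / 2) = (μ * Real.sqrt ((K : ℝ) - t ^ 2 / 2)) ^ 2 := by
            rw [mul_pow, Real.sq_sqrt hpos.le]
        _ ≤ 1.151 ^ 2 := pow_le_pow_left₀ (by positivity) (hle2.trans eight_mul_log_le) 2
    -- At t = √(2K) the overlap bound K - t²/2 is zero, so no condition on μ is needed.
    · rw [h, Real.sq_sqrt (by positivity)]
      norm_num
  have hov2 : ∀ S ∈ A, ∀ T ∈ A, S ≠ T → μ ^ 2 * ((S ∩ T).card : ℝ) ≤ μ ^ 2 * K := by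
    intro S hS T _ _
    refine mul_le_mul_of_nonneg_left ?_ (sq_nonneg μ)
    rw [← hK S (hAC hS)]
    exact_mod_cast Finset.card_le_card Finset.inter_subset_left
  -- The choice is a = min(1.151, μ√K): a² must dominate the overlaps without exceeding the variance
  -- μ²K. In the second case only the noise η = 0.01 is left in r.
  have main : ∃ a r : ℝ, 0 < a ∧ a ≤ 1.151 ∧ a ^ 2 ≤ μ ^ 2 * K ∧
      r = μ ^ 2 * K - a ^ 2 + 0.01 ∧
      (∀ S ∈ A, ∀ T ∈ A, S ≠ T → μ ^ 2 * ((S ∩ T).card : ℝ) ≤ a ^ 2) ∧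
      Real.exp r - 1 ≤ 0.1297 ^ 2 * A.card := by
    rcases le_total ((1.151 : ℝ) ^ 2) (μ ^ 2 * K) with h | h
    · refine ⟨1.151, _, by norm_num, le_rfl, h, rfl, hov1, ?_⟩
      rw [show μ ^ 2 * (K : ℝ) - 1.151 ^ 2 + 0.01 = μ ^ 2 * K + -1.314801 by ring, Real.exp_add]
      have := mul_le_mul hexp exp_neg_le (Real.exp_pos _).le (by positivity)
      linarith
    · have hsq : (μ * Real.sqrt K) ^ 2 = μ ^ 2 * K := by rw [mul_pow, Real.sq_sqrt hK0.le]
      refine ⟨μ * Real.sqrt K, _, by positivity, ?_, hsq.le, rfl, ?_, ?_⟩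
      · rw [← hsq] at h
        exact le_of_sq_le_sq h (by norm_num)
      · rwa [hsq]
      · rw [hsq, sub_self, zero_add]
        have h3 : Real.exp 0.01 ≤ 1.1 := by
          rw [← Real.le_log_iff_exp_le (by norm_num)]
          have := Real.one_sub_inv_le_log_of_pos (x := 1.1) (by norm_num)
          norm_num at this ⊢
          linarith
        linarith
  obtain ⟨a, r, ha0, ha1, haK, hr, hov, hexpr⟩ := main
  have hdev := integral_abs_likelihoodRatio_sub_one_le hA (fun S hS => hK S (hAC hS)) ha0 haK
    (by norm_num) hr hov (c := 0.1297) (by norm_num)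
  have hgauss := gaussianReal_real_Ioc_le_of_le (b := a / 2) (by linarith)
  -- With c = 0.1297 the bound on E|V - 1| is 0.1297, and 2 · 0.4351 + 0.1297 = 0.9999 ≤ 1.
  have hvar : (Real.exp r - 1) / A.card / 0.1297 ≤ 0.1297 := by
    rw [div_le_iff₀ (by norm_num), div_le_iff₀ (by linarith)]
    linarith
  have hrisk := one_sub_le_risk hA μ (measurable_optimalTest C μ)
  rw [optimalRisk_eq_risk hC hsymm hAC hA]
  linarith
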